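/- All graphs are finite and simple (no loops, no parallel edges). For a graph $G$, an \emph{$S_4$-pair} of $G$ is a pair of (not necessarily distinct) perfect matchings $M_1, M_2$ of $G$ such that the graph $G \setminus (M_1 \cup M_2)$, obtained by deleting the edges of $M_1\cup M_2$, is bipartite. The \emph{$S_4$-Conjecture} is the assertion that every connected bridgeless cubic graph has an $S_4$-pair. \textbf{Theorem.} Let $k$ be a positive integer and let $G$ be a connected cubic graph having exactly $k$ bridges, all of which lie on a single path of $G$. If the $S_4$-Conjecture is true, then $G$ admits an $S_4$-pair. -/

import Mathlib

/-- The set of bridges (cut-edges) of a simple graph. -/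
def SimpleGraph.bridgeSet {V : Type*} (G : SimpleGraph V) : Set (Sym2 V) :=
  {e | e ∈ G.edgeSet ∧ G.IsBridge e}

/-- An `S₄`-pair of `G`: two perfect matchings such that deleting the edges of their union from `G`
leaves a bipartite graph. -/
def SimpleGraph.IsS4Pair {V : Type*} (G : SimpleGraph V) (M₁ M₂ : G.Subgraph) : Prop :=
  M₁.IsPerfectMatching ∧ M₂.IsPerfectMatching ∧
    (G.deleteEdges (M₁.edgeSet ∪ M₂.edgeSet)).IsBipartite

/-- The `S₄`-Conjecture: every finite simple connected bridgeless cubic graph has an `S₄`-pair. -/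
def S4Conjecture : Prop :=
  ∀ (V : Type) [Fintype V] (G : SimpleGraph V) [G.LocallyFinite],
    G.Connected → G.IsRegularOfDegree 3 → G.bridgeSet = ∅ →
      ∃ M₁ M₂ : G.Subgraph, G.IsS4Pair M₁ M₂

/-!
Every component of `G` minus its bridges is 2-edge-connected. Since the bridges lie on one path, a
component meets one or two of them: beyond each bridge leaving it lies an end of the path, and the
parts of `G` beyond different bridges are disjoint (`not_three_bridges`). Every bridge belongs to
both perfect matchings that are sought, so in each component it suffices to find two matchings that
cover exactly the vertices not on a bridge and whose deletion leaves a bipartite graph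
(`hasS4Off_empty_of_components`). The components have all degrees 3 except at these one or two
vertices, where the degree is 2.

Two exceptional vertices `s`, `t` (`hasS4Off_pair`): replace every edge of the Petersen graph by a
copy of the component, attached at `s` and `t`. The result is cubic and bridgeless, so it has an
`S₄`-pair by the conjecture. As the component has even order, a perfect matching uses both or
neither of the two edges at a copy, and hence induces a perfect matching of the Petersen graph. Any
two perfect matchings of the Petersen graph share an edge, and in the copy at a shared edge both
matchings leave exactly `s` and `t` uncovered.

One exceptional vertex `u` (`hasS4Off_singleton`): replace a neighbour `x` of `u` by the Petersen
graph minus two adjacent vertices. One of the four vertices of degree 2 of this gadget stays free,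
so the first case applies with this vertex and `u` uncovered. Contracting the gadget back to `x`
gives matchings that cover all vertices but `u`. The remaining graph stays bipartite: if `x` retains
two edges, then the matchings are forced in the gadget and leave a path of even length between `u`
and the other remaining neighbour of `x`, just as the path through `x` requires.
-/

/-! ### Connectivity, partner maps and the conjecture -/

/-- `G` is connected and stays connected after the deletion of any one edge, in the language of
cuts: a two-colouring of the vertices that is constant along every edge except possibly `s(a, b)`
is constant. Here `s(a, b)` need not be an edge; `a = b` gives plain connectedness. -/
def SimpleGraph.IsTwoEdgeConn {V : Type*} (G : SimpleGraph V) : Prop :=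
  ∀ (f : V → Bool) (a b : V),
    (∀ u v, G.Adj u v → s(u, v) ≠ s(a, b) → f u = f v) → ∀ u v, f u = f v

/-- A matching of `G` covering exactly the vertices outside `X`, encoded as the involution `m`
that swaps matched vertices and fixes `X`. -/
structure SimpleGraph.IsPartnerMap {V : Type*} (G : SimpleGraph V) (X : Set V) (m : V → V) :
    Prop where
  invol : ∀ v, m (m v) = v
  fixed : ∀ v ∈ X, m v = v
  adj : ∀ v ∉ X, G.Adj v (m v)

/-- `G` has two matchings, each covering exactly the vertices outside `X`, such that deleting both
from `G` leaves a bipartite graph. For `X = ∅` this is an `S₄`-pair. -/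
def SimpleGraph.HasS4Off {V : Type*} (G : SimpleGraph V) (X : Set V) : Prop :=
  ∃ (m₁ m₂ : V → V) (c : V → Bool), G.IsPartnerMap X m₁ ∧ G.IsPartnerMap X m₂ ∧
    ∀ u v, G.Adj u v → m₁ u ≠ v → m₂ u ≠ v → c u ≠ c v

namespace SimpleGraph

variable {V W : Type*} {G : SimpleGraph V}

lemma IsTwoEdgeConn.preconnected (h : G.IsTwoEdgeConn) : G.Preconnected := by
  classical
  intro u v
  have := h (fun w => decide (G.Reachable u w)) u u (fun a b hab _ => by
    have : G.Reachable u a ↔ G.Reachable u b :=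
      ⟨fun h => h.trans hab.reachable, fun h => h.trans hab.symm.reachable⟩
    simp [this]) u v
  simpa using this

lemma IsTwoEdgeConn.bridgeSet_eq_empty (h : G.IsTwoEdgeConn) : G.bridgeSet = ∅ := by
  classical
  ext e
  induction e with | _ x y
  simp only [bridgeSet, Set.mem_ofPred_eq, Set.mem_empty_iff_false, iff_false, not_and]
  intro hxy hb
  rw [isBridge_iff] at hb
  have := h (fun w => decide ((G.deleteEdges {s(x, y)}).Reachable x w)) x y (fun a b hab hne => by
    have hab' : (G.deleteEdges {s(x, y)}).Adj a b := by
      rw [deleteEdges_adj]; exact ⟨hab, by simpa using hne⟩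
    have : (G.deleteEdges {s(x, y)}).Reachable x a ↔ (G.deleteEdges {s(x, y)}).Reachable x b :=
      ⟨fun h => h.trans hab'.reachable, fun h => h.trans hab'.symm.reachable⟩
    simp [this]) x y
  exact hb (by simpa using this)

lemma Subgraph.IsPerfectMatching.exists_isPartnerMap {M : G.Subgraph} (hM : M.IsPerfectMatching) :
    ∃ m : V → V, G.IsPartnerMap ∅ m ∧ ∀ u v, M.Adj u v ↔ m u = v := by
  have hM' := Subgraph.isPerfectMatching_iff.1 hM
  choose m hm hu using hM'
  have key : ∀ u v, M.Adj u v ↔ m u = v := fun u v =>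
    ⟨fun h => (hu u v h).symm, fun h => h ▸ hm u⟩
  exact ⟨m, ⟨fun v => (key _ _).1 (hm v).symm, by simp, fun v _ => (hm v).adj_sub⟩, key⟩

lemma IsPartnerMap.exists_isPerfectMatching {m : V → V} (hm : G.IsPartnerMap ∅ m) :
    ∃ M : G.Subgraph, M.IsPerfectMatching ∧ ∀ u v, M.Adj u v ↔ m u = v := by
  refine ⟨⟨Set.univ, fun u v => m u = v, ?_, by simp, ?_⟩, ?_, fun _ _ => Iff.rfl⟩
  · rintro u v rfl; exact hm.adj u (by simp)
  · exact ⟨fun u v h => by rw [← h]; exact hm.invol u⟩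
  · rw [Subgraph.isPerfectMatching_iff]
    exact fun v => ⟨m v, rfl, fun w (h : m v = w) => h.symm⟩

lemma hasS4Off_empty_iff : G.HasS4Off ∅ ↔ ∃ M₁ M₂ : G.Subgraph, G.IsS4Pair M₁ M₂ := by
  constructor
  · rintro ⟨m₁, m₂, c, h₁, h₂, hc⟩
    obtain ⟨M₁, hM₁, e₁⟩ := h₁.exists_isPerfectMatching
    obtain ⟨M₂, hM₂, e₂⟩ := h₂.exists_isPerfectMatching
    refine ⟨M₁, M₂, hM₁, hM₂, ⟨Coloring.mk (fun v => if c v then 0 else 1) ?_⟩⟩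
    intro u v huv
    simp only [deleteEdges_adj, Set.mem_union, Subgraph.mem_edgeSet, not_or, e₁, e₂] at huv
    have := hc u v huv.1 huv.2.1 huv.2.2
    cases h : c u <;> cases h' : c v <;> simp_all
  · rintro ⟨M₁, M₂, hM₁, hM₂, ⟨c⟩⟩
    obtain ⟨m₁, h₁, e₁⟩ := hM₁.exists_isPartnerMap
    obtain ⟨m₂, h₂, e₂⟩ := hM₂.exists_isPartnerMap
    refine ⟨m₁, m₂, fun v => decide (c v = 0), h₁, h₂, fun u v huv n₁ n₂ => ?_⟩
    have hne : c u ≠ c v := c.valid (by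
      simp only [deleteEdges_adj, Set.mem_union, Subgraph.mem_edgeSet, not_or, e₁, e₂]
      exact ⟨huv, n₁, n₂⟩)
    intro h
    have h' : (c u = 0) ↔ (c v = 0) := by simpa using h
    exact hne (by
      generalize c u = x at *; generalize c v = y at *
      revert x y; decide)

lemma HasS4Off.of_iso {H : SimpleGraph W} (e : G ≃g H) (h : H.HasS4Off ∅) : G.HasS4Off ∅ := by
  obtain ⟨m₁, m₂, c, h₁, h₂, hc⟩ := h
  have aux : ∀ m, H.IsPartnerMap ∅ m → G.IsPartnerMap ∅ (fun v => e.symm (m (e v))) :=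
    fun m hm => ⟨fun v => by simp [hm.invol], by simp, fun v _ => by
      rw [← e.map_adj_iff]; simpa using hm.adj (e v) (by simp)⟩
  refine ⟨_, _, fun v => c (e v), aux m₁ h₁, aux m₂ h₂, fun u v huv n₁ n₂ => ?_⟩
  refine hc _ _ (e.map_adj_iff.2 huv) (fun h => n₁ ?_) (fun h => n₂ ?_) <;> simp [h]

lemma IsTwoEdgeConn.of_iso {H : SimpleGraph W} (e : G ≃g H) (h : G.IsTwoEdgeConn) :
    H.IsTwoEdgeConn := by
  intro f a b hf u v
  have := h (fun x => f (e x)) (e.symm a) (e.symm b) (fun x y hxy hne => by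
    refine hf _ _ (e.map_adj_iff.2 hxy) fun h => hne ?_
    have := congrArg (Sym2.map e.symm) h
    simpa using this) (e.symm u) (e.symm v)
  simpa using this

/-- The conjecture only speaks about vertex types in `Type`; this is the form in which it is used,
for an arbitrary finite vertex type. -/
lemma IsTwoEdgeConn.hasS4Off_of_conjecture (hS4 : S4Conjecture) [Finite V] [Nonempty V]
    (h : G.IsTwoEdgeConn) (hdeg : ∀ v, (G.neighborSet v).ncard = 3) : G.HasS4Off ∅ := by
  classical
  obtain ⟨n, ⟨e⟩⟩ := Finite.exists_equiv_fin V
  let H : SimpleGraph (Fin n) := G.comap e.symm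
  let i : H ≃g G := Iso.comap e.symm G
  have hH : H.IsTwoEdgeConn := h.of_iso i.symm
  have : Nonempty (Fin n) := ⟨e (Classical.arbitrary V)⟩
  refine HasS4Off.of_iso i.symm (hasS4Off_empty_iff.2
    (hS4 (Fin n) H (connected_iff _ |>.2 ⟨hH.preconnected, this⟩) (fun v => ?_)
      hH.bridgeSet_eq_empty))
  rw [← card_neighborSet_eq_degree, ← Nat.card_eq_fintype_card, ← hdeg (i v)]
  exact Nat.card_congr (i.mapNeighborSet v)

end SimpleGraph

/-! ### The Petersen graph -/

/-- The Petersen graph as an incidence table: edge `i` joins `petersenEnd i true` and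
`petersenEnd i false`. Vertices `0, …, 4` form the outer cycle (edges `0, …, 4`), vertex `5 + j` is
joined to `j` by the spoke `5 + j`, and edge `10 + j` joins `5 + j` to `5 + (j + 2) % 5`. -/
def petersenEnd (i : Fin 15) (b : Bool) : Fin 10 :=
  match b with
  | true => ![0, 1, 2, 3, 4, 0, 1, 2, 3, 4, 5, 6, 7, 8, 9] i
  | false => ![1, 2, 3, 4, 0, 5, 6, 7, 8, 9, 7, 8, 9, 5, 6] i

lemma petersenEnd_card (v : Fin 10) :
    (Finset.univ.filter fun p : Fin 15 × Bool => petersenEnd p.1 p.2 = v).card = 3 := by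
  revert v; decide

/-- The Petersen graph is 2-edge-connected. -/
lemma petersenEnd_const (f : Fin 10 → Bool) (i₀ : Fin 15)
    (h : ∀ i, i ≠ i₀ → f (petersenEnd i true) = f (petersenEnd i false)) (u v : Fin 10) :
    f u = f v := by
  suffices H : ∀ w, f w = f 0 from (H u).trans (H v).symm
  have h' := fun i => or_iff_not_imp_left.2 (h i)
  clear h
  simp only [Fin.forall_fin_succ, petersenEnd] at h' ⊢
  fin_cases i₀ <;> simp at h' ⊢ <;> grind

/-- The edge sets of the six perfect matchings of the Petersen graph: the spokes, and for each
outer vertex `j` the perfect matching whose only spoke is the one at `j`. -/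
def petersenMatching (k : Fin 6) : List (Fin 15) :=
  ![[5, 6, 7, 8, 9], [5, 1, 3, 12, 11], [6, 2, 4, 13, 12], [7, 3, 0, 14, 13],
    [8, 4, 1, 10, 14], [9, 0, 2, 11, 10]] k

lemma exists_petersenMatching (N : Fin 15 → Prop)
    (hex : ∀ v, ∃ i b, petersenEnd i b = v ∧ N i)
    (huniq : ∀ i b j b', petersenEnd i b = petersenEnd j b' → N i → N j → i = j) :
    ∃ k, ∀ i ∈ petersenMatching k, N i := by
  -- Edges `i ≠ j` with a common end are not both in `N`.
  have hadj : ∀ p ∈ (Finset.univ.filter fun p : Fin 15 × Fin 15 =>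
      p.1 < p.2 ∧ ∃ b b', petersenEnd p.1 b = petersenEnd p.2 b'), ¬ N p.1 ∨ ¬ N p.2 := by
    intro p hp
    obtain ⟨hlt, b, b', h⟩ := (Finset.mem_filter.1 hp).2
    by_contra! hc
    exact hlt.ne (huniq _ b _ b' h hc.1 hc.2)
  rw [show (Finset.univ.filter fun p : Fin 15 × Fin 15 =>
      p.1 < p.2 ∧ ∃ b b', petersenEnd p.1 b = petersenEnd p.2 b') =
    {(0, 1), (1, 2), (2, 3), (3, 4), (0, 4), (10, 12), (11, 13), (12, 14), (10, 13), (11, 14),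
     (0, 5), (1, 6), (2, 7), (3, 8), (4, 9), (0, 6), (1, 7), (2, 8), (3, 9), (4, 5),
     (5, 10), (6, 11), (7, 12), (8, 13), (9, 14), (7, 10), (8, 11), (9, 12), (5, 13), (6, 14)}
    by decide +kernel] at hadj
  clear huniq
  simp [Fin.forall_fin_succ, Fin.exists_fin_succ, petersenEnd] at hex
  simp only [Fin.exists_fin_succ, petersenMatching]
  simp at hadj ⊢
  by_cases N 0 <;> by_cases N 1 <;> by_cases N 2 <;> by_cases N 3 <;> by_cases N 4 <;> simp_all

/-- Any two perfect matchings of the Petersen graph share an edge. -/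
lemma petersenEnd_inter (N₁ N₂ : Fin 15 → Prop)
    (hex₁ : ∀ v, ∃ i b, petersenEnd i b = v ∧ N₁ i)
    (huniq₁ : ∀ i b j b', petersenEnd i b = petersenEnd j b' → N₁ i → N₁ j → i = j)
    (hex₂ : ∀ v, ∃ i b, petersenEnd i b = v ∧ N₂ i)
    (huniq₂ : ∀ i b j b', petersenEnd i b = petersenEnd j b' → N₂ i → N₂ j → i = j) :
    ∃ i, N₁ i ∧ N₂ i := by
  obtain ⟨k, hk⟩ := exists_petersenMatching N₁ hex₁ huniq₁
  obtain ⟨l, hl⟩ := exists_petersenMatching N₂ hex₂ huniq₂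
  have : ∀ k l : Fin 6, ∃ i ∈ petersenMatching k, i ∈ petersenMatching l := by decide
  obtain ⟨i, hi, hi'⟩ := this k l
  exact ⟨i, hk i hi, hl i hi'⟩

/-! ### Replacing every edge of a multigraph by a copy of a graph with two poles -/

namespace SimpleGraph

variable {A ι W : Type*} {P : SimpleGraph W}

/-- The multigraph with edges `ι`, vertices `A` and incidences `e : ι → Bool → A`, with every edge
`i` replaced by a copy of `P` whose vertex `pole b` is joined to the end `e i b`. -/
def replaceEdges (e : ι → Bool → A) (P : SimpleGraph W) (pole : Bool → W) :
    SimpleGraph (A ⊕ ι × W) where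
  Adj
    | .inl v, .inr q => ∃ b, e q.1 b = v ∧ pole b = q.2
    | .inr q, .inl v => ∃ b, e q.1 b = v ∧ pole b = q.2
    | .inr p, .inr q => p.1 = q.1 ∧ P.Adj p.2 q.2
    | .inl _, .inl _ => False
  symm := ⟨by
    rintro (v | p) (w | q) h
    · exact h
    · exact h
    · exact h
    · exact ⟨h.1.symm, h.2.symm⟩⟩
  loopless := ⟨by
    rintro (v | p) h
    · exact h
    · exact h.2.ne rfl⟩

lemma isTwoEdgeConn_replaceEdges {e : ι → Bool → A} {pole : Bool → W} [Nonempty ι]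
    (hpole : pole true ≠ pole false) (hP : P.IsTwoEdgeConn)
    (he : ∀ (f : A → Bool) (i₀ : ι), (∀ i, i ≠ i₀ → f (e i true) = f (e i false)) →
      ∀ u v, f u = f v) :
    (replaceEdges e P pole).IsTwoEdgeConn := by
  intro f a b hf
  have hcopy : ∀ i w w', f (.inr (i, w)) = f (.inr (i, w')) := by
    intro i
    refine hP (fun w => f (.inr (i, w))) (Sum.elim (fun _ => pole true) Prod.snd a)
      (Sum.elim (fun _ => pole true) Prod.snd b) fun u v huv hne => ?_
    refine hf _ _ ⟨rfl, huv⟩ fun h => hne ?_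
    simpa using congrArg (Sym2.map (Sum.elim (fun _ => pole true) Prod.snd)) h
  -- Only the two edges at the ends of a single copy `i₀` can be affected by the exceptional edge.
  obtain ⟨i₀, hi₀⟩ : ∃ i₀, ∀ i, i ≠ i₀ → ∀ β,
      f (.inl (e i β)) = f (.inr (i, pole β)) := by
    refine ⟨Sum.elim (fun _ => Sum.elim (fun _ => Classical.arbitrary ι) Prod.fst b) Prod.fst a,
      fun i hi β => hf _ _ ⟨β, rfl, rfl⟩ fun h => hi ?_⟩
    rcases Sym2.eq_iff.1 h with ⟨rfl, rfl⟩ | ⟨rfl, rfl⟩ <;> rfl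
  obtain ⟨β₀, hβ₀⟩ : ∃ β, f (.inl (e i₀ β)) = f (.inr (i₀, pole β)) := by
    by_contra! hno
    have h1 : s(.inl (e i₀ true), .inr (i₀, pole true)) = s(a, b) := by
      by_contra h; exact hno _ (hf _ _ ⟨true, rfl, rfl⟩ h)
    have h2 : s(.inl (e i₀ false), .inr (i₀, pole false)) = s(a, b) := by
      by_contra h; exact hno _ (hf _ _ ⟨false, rfl, rfl⟩ h)
    rw [← h2] at h1
    simp [hpole] at h1
  have hA := he (fun v => f (.inl v)) i₀ fun i hi => by
    rw [hi₀ i hi, hi₀ i hi, hcopy]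
  have hall : ∀ x, f x = f (.inl (e i₀ β₀)) := by
    rintro (v | ⟨i, w⟩)
    · exact hA _ _
    · by_cases hi : i = i₀
      · rw [hi, hβ₀]; exact hcopy _ _ _
      · rw [hcopy i w (pole true), ← hi₀ i hi]; exact hA _ _
  exact fun u v => (hall u).trans (hall v).symm

lemma ncard_neighborSet_replaceEdges_inl [DecidableEq A] [Fintype ι] {e : ι → Bool → A}
    {pole : Bool → W} (hpole : pole true ≠ pole false) (v : A) :
    ((replaceEdges e P pole).neighborSet (.inl v)).ncard =
      (Finset.univ.filter fun p : ι × Bool => e p.1 p.2 = v).card := by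
  rw [← Set.ncard_coe_finset]
  have : (replaceEdges e P pole).neighborSet (.inl v) =
      (fun p : ι × Bool => (.inr (p.1, pole p.2) : A ⊕ ι × W)) ''
        ((Finset.univ.filter fun p : ι × Bool => e p.1 p.2 = v : Finset (ι × Bool)) :
          Set (ι × Bool)) := by
    ext x
    rcases x with w | ⟨i, w⟩
    · simp [replaceEdges]
    · simp [replaceEdges]
      grind
  rw [this, Set.ncard_image_of_injective]
  rintro ⟨i, b⟩ ⟨j, b'⟩ h
  simp only [Sum.inr.injEq, Prod.mk.injEq] at h
  cases b <;> cases b' <;> simp_all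

lemma ncard_neighborSet_replaceEdges_inr {e : ι → Bool → A}
    {pole : Bool → W} (i : ι) {w : W} (hw : ∀ b, pole b ≠ w) :
    ((replaceEdges e P pole).neighborSet (.inr (i, w))).ncard = (P.neighborSet w).ncard := by
  have : (replaceEdges e P pole).neighborSet (.inr (i, w)) =
      (fun w' => (.inr (i, w') : A ⊕ ι × W)) '' P.neighborSet w := by
    ext x
    rcases x with v | ⟨j, w'⟩
    · simp [replaceEdges, hw]
    · simp [replaceEdges]
      grind
  rw [this, Set.ncard_image_of_injective]
  intro a b h
  simpa using h

lemma ncard_neighborSet_replaceEdges_pole [Finite W] {e : ι → Bool → A}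
    {pole : Bool → W} (hpole : pole true ≠ pole false) (i : ι) (b : Bool) :
    ((replaceEdges e P pole).neighborSet (.inr (i, pole b))).ncard =
      (P.neighborSet (pole b)).ncard + 1 := by
  have : (replaceEdges e P pole).neighborSet (.inr (i, pole b)) =
      insert (.inl (e i b)) ((fun w' => (.inr (i, w') : A ⊕ ι × W)) '' P.neighborSet (pole b)) := by
    ext x
    rcases x with v | ⟨j, w'⟩
    · cases b <;> simp [replaceEdges, hpole, hpole.symm, eq_comm]
    · simp [replaceEdges]
      grind
  rw [this, Set.ncard_insert_of_notMem (by simp) (Set.toFinite _), Set.ncard_image_of_injective]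
  intro a b h
  simpa using h

/-! ### Restricting matchings to a copy -/

lemma IsPartnerMap.card_modEq [Finite W] {X : Set W} {m : W → W} (hm : P.IsPartnerMap X m) :
    Nat.card W ≡ X.ncard [MOD 2] := by
  classical
  have := Fintype.ofFinite W
  have hX : Function.fixedPoints m = X := by
    ext w
    refine ⟨fun h => ?_, fun h => hm.fixed w h⟩
    by_contra hw
    exact (hm.adj w hw).ne h.symm
  have := Equiv.Perm.card_fixedPoints_modEq (α := W) (f := m) (p := 2) (n := 1)
    (funext fun w => hm.invol w)
  rw [Nat.card_eq_fintype_card, ← hX, ← Nat.card_coe_set_eq, Nat.card_eq_fintype_card]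
  exact this

/-- The partner map that a partner map of `replaceEdges e P pole` induces on the copy `i`:
vertices matched outside the copy become fixed points. -/
def copyMap (m : A ⊕ ι × W → A ⊕ ι × W) (i : ι) (w : W) : W :=
  Sum.elim (fun _ => w) Prod.snd (m (.inr (i, w)))

lemma IsPartnerMap.copyMap {e : ι → Bool → A} {pole : Bool → W} {m : A ⊕ ι × W → A ⊕ ι × W}
    (hm : (replaceEdges e P pole).IsPartnerMap ∅ m) (i : ι) :
    P.IsPartnerMap {w | ∃ v, m (.inr (i, w)) = .inl v} (copyMap m i) := by
  have hadj := fun w => hm.adj (.inr (i, w)) (by simp)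
  refine ⟨fun w => ?_, ?_, fun w hw => ?_⟩
  · have h1 := hadj w
    have h2 := hm.invol (.inr (i, w))
    rcases h : m (.inr (i, w)) with v | ⟨j, w'⟩
    · simp [SimpleGraph.copyMap, h]
    · rw [h] at h1 h2
      obtain rfl : i = j := h1.1
      simp [SimpleGraph.copyMap, h, h2]
  · rintro w ⟨v, hv⟩
    simp [SimpleGraph.copyMap, hv]
  · have h1 := hadj w
    rcases h : m (.inr (i, w)) with v | ⟨j, w'⟩
    · exact absurd ⟨v, h⟩ hw
    · rw [h] at h1
      simpa [SimpleGraph.copyMap, h] using h1.2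

lemma even_card_of_two_poles [Finite W] {s t : W} (hst : s ≠ t)
    (hs : (P.neighborSet s).ncard = 2) (ht : (P.neighborSet t).ncard = 2)
    (h : ∀ w, w ≠ s → w ≠ t → (P.neighborSet w).ncard = 3) : Even (Nat.card W) := by
  classical
  have := Fintype.ofFinite W
  have hdeg : ∀ w, P.degree w = (P.neighborSet w).ncard := fun w => by
    rw [← card_neighborSet_eq_degree, ← Nat.card_eq_fintype_card, Nat.card_coe_set_eq]
  have hodd := P.even_card_odd_degree_vertices
  have hset : (Finset.univ.filter fun v => Odd (P.degree v)) = Finset.univ \ {s, t} := by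
    ext w
    by_cases h1 : w = s
    · subst h1; simp [hdeg, hs]
    by_cases h2 : w = t
    · subst h2; simp [hdeg, ht]
    simp [hdeg, h w h1 h2, h1, h2]
    decide
  rw [hset, Finset.card_sdiff_of_subset (Finset.subset_univ _), Finset.card_pair hst,
    Finset.card_univ] at hodd
  have : 2 ≤ Fintype.card W := by
    rw [← Finset.card_pair hst]; exact Finset.card_le_univ _
  rw [Nat.card_eq_fintype_card]
  rwa [Nat.even_sub this, iff_true_right even_two] at hodd

/-- A parity argument: a matching of `replaceEdges e P pole` uses both or neither of the two edges
that link a copy of `P` to the rest. -/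
lemma IsPartnerMap.exists_eq_inl_of_pole [Finite W] {e : ι → Bool → A} {pole : Bool → W}
    (hW : Even (Nat.card W)) {m : A ⊕ ι × W → A ⊕ ι × W}
    (hm : (replaceEdges e P pole).IsPartnerMap ∅ m) {i : ι} {b : Bool} {v : A}
    (h : m (.inr (i, pole b)) = .inl v) (b' : Bool) : ∃ v', m (.inr (i, pole b')) = .inl v' := by
  set X : Set W := {w | ∃ v, m (.inr (i, w)) = .inl v}
  have hb : pole b ∈ X := ⟨v, h⟩
  have hX : X ⊆ {pole b, pole !b} := by
    rintro w ⟨v, hv⟩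
    have := hm.adj (.inr (i, w)) (by simp)
    rw [hv] at this
    obtain ⟨b'', -, rfl⟩ := this
    cases b <;> cases b'' <;> simp
  by_contra hb'
  have hne : b' = !b := by
    cases b <;> cases b' <;> first | rfl | exact absurd hb hb'
  subst hne
  have hX' : X = {pole b} := by
    refine Set.Subset.antisymm (fun w hw => ?_) (by simpa using hb)
    rcases hX hw with rfl | rfl
    · rfl
    · exact absurd hw hb'
  have := (hm.copyMap i).card_modEq
  rw [show {w | ∃ v, m (.inr (i, w)) = .inl v} = X from rfl, hX', Set.ncard_singleton] at this
  rw [Nat.even_iff] at hW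
  have := this.symm.trans (show Nat.card W ≡ 0 [MOD 2] from hW)
  exact absurd this (by decide)

/-- Let all degrees of the 2-edge-connected graph `P` be 3, except that `s` and `t` have
degree 2. By the conjecture `P` has two matchings covering exactly the vertices other than `s` and
`t` whose deletion leaves a bipartite graph: replace every edge of the Petersen graph by a copy of
`P`; an `S₄`-pair induces two perfect matchings of the Petersen graph, and the copy at an edge
common to both is as required. -/
theorem hasS4Off_pair (hS4 : S4Conjecture) [Finite W] {s t : W} (hst : s ≠ t)
    (hP : P.IsTwoEdgeConn) (hs : (P.neighborSet s).ncard = 2) (ht : (P.neighborSet t).ncard = 2)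
    (h : ∀ w, w ≠ s → w ≠ t → (P.neighborSet w).ncard = 3) : P.HasS4Off {s, t} := by
  let pole : Bool → W := fun b => cond b s t
  have hpole : pole true ≠ pole false := hst
  have hW := even_card_of_two_poles hst hs ht h
  let J := replaceEdges petersenEnd P pole
  have hdeg : ∀ x, (J.neighborSet x).ncard = 3 := by
    rintro (v | ⟨i, w⟩)
    · exact (ncard_neighborSet_replaceEdges_inl hpole v).trans (petersenEnd_card v)
    · by_cases h1 : w = s
      · subst h1
        exact (ncard_neighborSet_replaceEdges_pole hpole i true).trans (by simp [pole, hs])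
      by_cases h2 : w = t
      · subst h2
        exact (ncard_neighborSet_replaceEdges_pole hpole i false).trans (by simp [pole, ht])
      · refine (ncard_neighborSet_replaceEdges_inr i ?_).trans (h w h1 h2)
        rintro (_ | _)
        exacts [fun h => h2 h.symm, fun h => h1 h.symm]
  obtain ⟨m₁, m₂, c, hm₁, hm₂, hc⟩ :=
    (isTwoEdgeConn_replaceEdges hpole hP petersenEnd_const : J.IsTwoEdgeConn).hasS4Off_of_conjecture
      hS4 hdeg
  -- An edge of the Petersen graph is used by the induced matching if the copy is left at its poles.
  let N : (Fin 10 ⊕ Fin 15 × W → Fin 10 ⊕ Fin 15 × W) → Fin 15 → Prop := fun m i =>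
    ∃ b v, m (.inr (i, pole b)) = .inl v
  have hN : ∀ m, J.IsPartnerMap ∅ m → ∀ i, N m i → ∀ b,
      m (.inr (i, pole b)) = .inl (petersenEnd i b) := by
    rintro m hm i ⟨b, v, hbv⟩ b'
    obtain ⟨v', hv'⟩ := hm.exists_eq_inl_of_pole hW hbv b'
    have hadj := hm.adj (.inr (i, pole b')) (by simp)
    rw [hv'] at hadj ⊢
    obtain ⟨b'', rfl, hb''⟩ := hadj
    have : b'' = b' := by
      cases b' <;> cases b'' <;> first | rfl | exact absurd hb'' hpole | exact absurd hb''.symm hpole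
    rw [this]
  have hex : ∀ m, J.IsPartnerMap ∅ m → ∀ v, ∃ i b, petersenEnd i b = v ∧ N m i := by
    intro m hm v
    have hadj := hm.adj (.inl v) (by simp)
    have hinv := hm.invol (.inl v)
    rcases hmv : m (.inl v) with w | ⟨i, w⟩
    · rw [hmv] at hadj; exact hadj.elim
    · rw [hmv] at hadj hinv
      obtain ⟨b, hb, rfl⟩ := hadj
      exact ⟨i, b, hb, b, v, hinv⟩
  have huniq : ∀ m, J.IsPartnerMap ∅ m → ∀ i b j b', petersenEnd i b = petersenEnd j b' →
      N m i → N m j → i = j := by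
    intro m hm i b j b' hij hi hj
    have h1 := hN m hm i hi b
    have h2 := hN m hm j hj b'
    rw [← hij, ← h1] at h2
    have := congrArg m h2
    rw [hm.invol, hm.invol] at this
    simpa using (congrArg (Sum.elim (fun _ => i) Prod.fst) this).symm
  obtain ⟨i, hi₁, hi₂⟩ := petersenEnd_inter (N m₁) (N m₂) (hex _ hm₁) (huniq _ hm₁) (hex _ hm₂)
    (huniq _ hm₂)
  have hX : ∀ m, J.IsPartnerMap ∅ m → N m i → {w | ∃ v, m (.inr (i, w)) = .inl v} = {s, t} := by
    intro m hm hi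
    ext w
    constructor
    · rintro ⟨v, hv⟩
      have hadj := hm.adj (.inr (i, w)) (by simp)
      rw [hv] at hadj
      obtain ⟨b, -, rfl⟩ := hadj
      cases b <;> simp [pole]
    · rintro (rfl | rfl)
      · exact ⟨_, hN m hm i hi true⟩
      · exact ⟨_, hN m hm i hi false⟩
  refine ⟨copyMap m₁ i, copyMap m₂ i, fun w => c (.inr (i, w)), hX m₁ hm₁ hi₁ ▸ hm₁.copyMap i,
    hX m₂ hm₂ hi₂ ▸ hm₂.copyMap i, fun u v huv n₁ n₂ => hc _ _ ⟨rfl, huv⟩ ?_ ?_⟩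
  · intro h; exact n₁ (by simp [copyMap, h])
  · intro h; exact n₂ (by simp [copyMap, h])

end SimpleGraph

/-! ### Expanding a vertex -/

namespace SimpleGraph

variable {V R : Type*} {B : SimpleGraph V} {Q : SimpleGraph R}

/-- The graph `B` with the vertex `x` replaced by a copy of `Q`; the edge from a neighbour `v` of
`x` to `x` becomes an edge from `v` to the vertex `port v` of `Q`. -/
def expandVertex (B : SimpleGraph V) (x : V) (Q : SimpleGraph R) (port : V → R) :
    SimpleGraph ({v // v ≠ x} ⊕ R) where
  Adj
    | .inl v, .inl w => B.Adj v w
    | .inl v, .inr j => B.Adj x v ∧ port v = j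
    | .inr j, .inl v => B.Adj x v ∧ port v = j
    | .inr j, .inr k => Q.Adj j k
  symm := ⟨by
    rintro (v | p) (w | q) h
    · exact h.symm
    · exact h
    · exact h
    · exact h.symm⟩
  loopless := ⟨by
    rintro (v | p) h
    · exact h.ne rfl
    · exact h.ne rfl⟩

lemma isTwoEdgeConn_expandVertex [Nonempty R] {x : V} {port : V → R} (hB : B.IsTwoEdgeConn)
    (hQ : Q.IsTwoEdgeConn) : (expandVertex B x Q port).IsTwoEdgeConn := by
  classical
  intro f a b hf
  let r₀ : R := Classical.arbitrary R
  have hR : ∀ j, f (.inr j) = f (.inr r₀) := by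
    intro j
    refine hQ (fun k => f (.inr k)) (Sum.elim (fun _ => r₀) id a) (Sum.elim (fun _ => r₀) id b)
      (fun u v huv hne => hf _ _ huv fun h => hne ?_) j r₀
    simpa using congrArg (Sym2.map (Sum.elim (fun _ => r₀) id)) h
  let ρ : {v // v ≠ x} ⊕ R → V := Sum.elim Subtype.val (fun _ => x)
  let g : V → Bool := fun v => if h : v = x then f (.inr r₀) else f (.inl ⟨v, h⟩)
  have hg : ∀ y, f y = g (ρ y) := by
    rintro (⟨v, hv⟩ | j)
    · simp [g, ρ, hv]
    · simpa [g, ρ] using hR j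
  have hstep : ∀ y z, (expandVertex B x Q port).Adj y z → s(ρ y, ρ z) ≠ s(ρ a, ρ b) →
      g (ρ y) = g (ρ z) := by
    intro y z hyz hne
    rw [← hg, ← hg]
    refine hf y z hyz fun h => hne ?_
    simpa using congrArg (Sym2.map ρ) h
  have hconst := hB g (ρ a) (ρ b) fun v w hvw hne => by
    by_cases hv : v = x
    · subst hv
      exact hstep (.inr (port w)) (.inl ⟨w, hvw.ne'⟩) ⟨hvw, rfl⟩ hne
    by_cases hw : w = x
    · subst hw
      exact hstep (.inl ⟨v, hv⟩) (.inr (port v)) ⟨hvw.symm, rfl⟩ hne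
    exact hstep (.inl ⟨v, hv⟩) (.inl ⟨w, hw⟩) hvw hne
  intro y z
  rw [hg, hg]
  exact hconst _ _

lemma ncard_neighborSet_expandVertex_inl {x : V} {port : V → R} (v : {v // v ≠ x}) :
    ((expandVertex B x Q port).neighborSet (.inl v)).ncard = (B.neighborSet v).ncard := by
  classical
  have : (expandVertex B x Q port).neighborSet (.inl v) =
      (fun w => if h : w = x then .inr (port v) else .inl ⟨w, h⟩ : V → {v // v ≠ x} ⊕ R) ''
        B.neighborSet v := by
    ext y
    rcases y with ⟨w, hw⟩ | j
    · simp only [mem_neighborSet, Set.mem_image, expandVertex]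
      constructor
      · intro h
        exact ⟨w, h, by simp [hw]⟩
      · rintro ⟨w', h, h'⟩
        split_ifs at h'
        simpa using (by simpa using h' : w' = w) ▸ h
    · simp only [mem_neighborSet, Set.mem_image, expandVertex]
      constructor
      · rintro ⟨h, rfl⟩
        exact ⟨x, h.symm, by simp⟩
      · rintro ⟨w', h, h'⟩
        split_ifs at h' with hx
        subst hx
        exact ⟨h.symm, by simpa using h'⟩
  rw [this, Set.ncard_image_of_injective]
  intro w w' h
  dsimp only at h
  split_ifs at h with h1 h2 h2
  · rw [h1, h2]
  · simpa using h

lemma ncard_neighborSet_expandVertex_inr {x : V} {port : V → R} {j : R}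
    (hj : ∀ v, B.Adj x v → port v ≠ j) :
    ((expandVertex B x Q port).neighborSet (.inr j)).ncard = (Q.neighborSet j).ncard := by
  have : (expandVertex B x Q port).neighborSet (.inr j) = Sum.inr '' Q.neighborSet j := by
    ext y
    rcases y with ⟨w, hw⟩ | k
    · simpa [expandVertex] using hj w
    · simp [expandVertex]
  rw [this, Set.ncard_image_of_injective _ Sum.inr_injective]

lemma ncard_neighborSet_expandVertex_port [Finite R] {x : V} {port : V → R} {u : V}
    (hu : B.Adj x u) (huniq : ∀ v, B.Adj x v → port v = port u → v = u) :
    ((expandVertex B x Q port).neighborSet (.inr (port u))).ncard =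
      (Q.neighborSet (port u)).ncard + 1 := by
  have : (expandVertex B x Q port).neighborSet (.inr (port u)) =
      insert (.inl ⟨u, hu.ne'⟩) (Sum.inr '' Q.neighborSet (port u)) := by
    ext y
    rcases y with ⟨w, hw⟩ | k
    · simp only [mem_neighborSet, expandVertex, Set.mem_insert_iff, Sum.inl.injEq,
        Subtype.mk.injEq, Set.mem_image, reduceCtorEq, and_false, exists_false, or_false]
      exact ⟨fun h => huniq w h.1 h.2, by rintro rfl; exact ⟨hu, rfl⟩⟩
    · simp [expandVertex]
  rw [this, Set.ncard_insert_of_notMem (by simp) (Set.toFinite _),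
    Set.ncard_image_of_injective _ Sum.inr_injective]

/-! ### The Petersen graph minus two adjacent vertices -/

/-- The Petersen graph minus two adjacent vertices: the 8-cycle `0, …, 7` with the chords `15` and
`37`. The vertices of degree 2 are the even ones. -/
def petersenMinusEdge : SimpleGraph (Fin 8) where
  Adj i j := j = i + 1 ∨ i = j + 1 ∨ (i, j) ∈ [((1 : Fin 8), (5 : Fin 8)), (5, 1), (3, 7), (7, 3)]
  symm := ⟨by decide⟩
  loopless := ⟨by decide⟩

instance : DecidableRel petersenMinusEdge.Adj := fun i j => by
  unfold petersenMinusEdge; infer_instance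

lemma isTwoEdgeConn_petersenMinusEdge : petersenMinusEdge.IsTwoEdgeConn := by
  intro f a b hf u v
  -- The Hamiltonian cycle `0, …, 7` has at most one edge equal to `s(a, b)`.
  have hinj : ∀ k l : Fin 8, s(k, k + 1) = s(l, l + 1) → k = l := by decide
  obtain ⟨k₀, hk₀⟩ : ∃ k₀, ∀ k, k ≠ k₀ → f k = f (k + 1) := by
    by_cases h : ∃ k : Fin 8, s(k, k + 1) = s(a, b)
    · obtain ⟨k₀, h⟩ := h
      exact ⟨k₀, fun k hk => hf _ _ (Or.inl rfl) fun h' => hk (hinj _ _ (h'.trans h.symm))⟩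
    · push Not at h
      exact ⟨0, fun k _ => hf _ _ (Or.inl rfl) (h k)⟩
  suffices H : ∀ w, f w = f 0 from (H u).trans (H v).symm
  have h' := fun i => or_iff_not_imp_left.2 (hk₀ i)
  clear hk₀ hf
  simp only [Fin.forall_fin_succ] at h' ⊢
  fin_cases k₀ <;> simp at h' ⊢ <;> grind

lemma ncard_neighborSet_petersenMinusEdge (j : Fin 8) :
    (petersenMinusEdge.neighborSet j).ncard = if j.val % 2 = 0 then 2 else 3 := by
  rw [← Nat.card_coe_set_eq, Nat.card_eq_fintype_card, card_neighborSet_eq_degree]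
  revert j
  decide

/-- How a matching that misses the vertices `u` and `inr 0` passes through the copy of
`petersenMinusEdge` that replaces the vertex `x` with neighbours `u`, `a`, `b`, attached at `4`,
`2`, `6`: it uses exactly one of the edges at `a` and `b`, and is then determined on the copy. -/
lemma IsPartnerMap.petersenMinusEdge_cases {x u a b : V} {port : V → Fin 8}
    (hx : ∀ v, B.Adj x v → v = u ∨ v = a ∨ v = b)
    (hux : u ≠ x) (hax : a ≠ x) (hbx : b ≠ x) (hu : port u = 4) (ha : port a = 2) (hb : port b = 6)
    {m : {v // v ≠ x} ⊕ Fin 8 → {v // v ≠ x} ⊕ Fin 8}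
    (hm : (expandVertex B x petersenMinusEdge port).IsPartnerMap {.inl ⟨u, hux⟩, .inr 0} m) :
    (m (.inr 4) = .inr 3 ∧ m (.inr 5) = .inr 1 ∧ m (.inr 7) = .inr 6 ∧
      m (.inr 2) = .inl ⟨a, hax⟩) ∨
    (m (.inr 4) = .inr 5 ∧ m (.inr 3) = .inr 7 ∧ m (.inr 1) = .inr 2 ∧
      m (.inr 6) = .inl ⟨b, hbx⟩) := by
  have f0 : m (.inr 0) = .inr 0 := hm.fixed _ (by simp)
  have fu : m (.inl ⟨u, hux⟩) = .inl ⟨u, hux⟩ := hm.fixed _ (by simp)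
  have key : ∀ j : Fin 8, j ≠ 0 → (∃ k, m (.inr j) = .inr k ∧ petersenMinusEdge.Adj j k) ∨
      (j = 2 ∧ m (.inr j) = .inl ⟨a, hax⟩) ∨ (j = 6 ∧ m (.inr j) = .inl ⟨b, hbx⟩) := by
    intro j hj
    have hadj := hm.adj (.inr j) (by simpa using hj)
    have hinv := hm.invol (.inr j)
    rcases h : m (.inr j) with ⟨v, hv⟩ | k
    · rw [h] at hadj hinv
      obtain ⟨h1, rfl⟩ := hadj
      rcases hx v h1 with rfl | rfl | rfl
      · rw [fu] at hinv; simp at hinv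
      · exact Or.inr (Or.inl ⟨ha, rfl⟩)
      · exact Or.inr (Or.inr ⟨hb, rfl⟩)
    · rw [h] at hadj
      exact Or.inl ⟨k, rfl, hadj⟩
  have hinv := fun j => hm.invol (.inr j)
  have n1 : ∀ k, petersenMinusEdge.Adj 1 k → k = 0 ∨ k = 2 ∨ k = 5 := by decide
  have n2 : ∀ k, petersenMinusEdge.Adj 2 k → k = 1 ∨ k = 3 := by decide
  have n3 : ∀ k, petersenMinusEdge.Adj 3 k → k = 2 ∨ k = 4 ∨ k = 7 := by decide
  have n4 : ∀ k, petersenMinusEdge.Adj 4 k → k = 3 ∨ k = 5 := by decide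
  have n5 : ∀ k, petersenMinusEdge.Adj 5 k → k = 1 ∨ k = 4 ∨ k = 6 := by decide
  have n6 : ∀ k, petersenMinusEdge.Adj 6 k → k = 5 ∨ k = 7 := by decide
  have n7 : ∀ k, petersenMinusEdge.Adj 7 k → k = 0 ∨ k = 3 ∨ k = 6 := by decide
  have k1 := key 1 (by decide)
  have k2 := key 2 (by decide)
  have k3 := key 3 (by decide)
  have k4 := key 4 (by decide)
  have k5 := key 5 (by decide)
  have k6 := key 6 (by decide)
  have k7 := key 7 (by decide)
  have i1 := hinv 1
  have i2 := hinv 2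
  have i3 := hinv 3
  have i4 := hinv 4
  have i5 := hinv 5
  have i6 := hinv 6
  have i7 := hinv 7
  clear key hinv hm
  simp at k1 k2 k3 k4 k5 k6 k7
  obtain ⟨k, hk, hk'⟩ := k4
  rcases n4 k hk' with rfl | rfl
  · left
    refine ⟨hk, ?_⟩
    grind
  · right
    refine ⟨hk, ?_⟩
    grind

end SimpleGraph

/-! ### Matchings missing a single vertex -/

namespace SimpleGraph

variable {V : Type*} {B : SimpleGraph V}

/-- Contracting the copy of `petersenMinusEdge` back to `x` turns a matching missing `u` and
`inr 0` into a matching of `B` missing only `u`; the partner of `x` is `a` or `b`, according to how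
the matching passes through the copy. -/
lemma IsPartnerMap.exists_contract {x u a b : V} {port : V → Fin 8}
    (hx : ∀ v, B.Adj x v ↔ v = u ∨ v = a ∨ v = b)
    (hux : u ≠ x) (hax : a ≠ x) (hbx : b ≠ x) (hu : port u = 4) (ha : port a = 2) (hb : port b = 6)
    {m : {v // v ≠ x} ⊕ Fin 8 → {v // v ≠ x} ⊕ Fin 8}
    (hm : (expandVertex B x petersenMinusEdge port).IsPartnerMap {.inl ⟨u, hux⟩, .inr 0} m) :
    ∃ μ : V → V, B.IsPartnerMap {u} μ ∧
      (∀ v w, m (.inl v) = .inl w → μ v = w) ∧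
      ((μ x = a ∧ m (.inr 4) = .inr 3 ∧ m (.inr 5) = .inr 1 ∧ m (.inr 7) = .inr 6) ∨
       (μ x = b ∧ m (.inr 4) = .inr 5 ∧ m (.inr 3) = .inr 7 ∧ m (.inr 1) = .inr 2)) := by
  classical
  have fu : m (.inl ⟨u, hux⟩) = .inl ⟨u, hux⟩ := hm.fixed _ (by simp)
  have hcases := hm.petersenMinusEdge_cases (fun v => (hx v).1) hux hax hbx hu ha hb
  -- The partner `z` of `x` is the only neighbour of `x` matched into the copy.
  obtain ⟨z, hzx, hz, hzuniq, hz'⟩ : ∃ z, ∃ hzx : z ≠ x, (∃ j, m (.inl ⟨z, hzx⟩) = .inr j) ∧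
      (∀ (v : {v // v ≠ x}) j, m (.inl v) = .inr j → v = z) ∧
      ((z = a ∧ m (.inr 4) = .inr 3 ∧ m (.inr 5) = .inr 1 ∧ m (.inr 7) = .inr 6) ∨
       (z = b ∧ m (.inr 4) = .inr 5 ∧ m (.inr 3) = .inr 7 ∧ m (.inr 1) = .inr 2)) := by
    have hport : ∀ (v : {v // v ≠ x}) j, m (.inl v) = .inr j →
        (v = a ∧ m (.inr 2) = .inl v) ∨ (v = b ∧ m (.inr 6) = .inl v) := by
      intro v j hj
      have hvu : v ≠ ⟨u, hux⟩ := by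
        rintro rfl; rw [fu] at hj; simp at hj
      have hadj := hm.adj (.inl v) (by simpa using hvu)
      have hinv := hm.invol (.inl v)
      rw [hj] at hadj hinv
      obtain ⟨h1, rfl⟩ := hadj
      rcases (hx v).1 h1 with h | h | h
      · exact absurd (Subtype.ext h) hvu
      · left; exact ⟨h, by rw [← hinv, h, ha]⟩
      · right; exact ⟨h, by rw [← hinv, h, hb]⟩
    rcases hcases with ⟨h4, h5, h7, h2⟩ | ⟨h4, h3, h1, h6⟩
    · refine ⟨a, hax, ⟨2, by rw [← h2, hm.invol]⟩, fun v j hj => ?_, Or.inl ⟨rfl, h4, h5, h7⟩⟩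
      rcases hport v j hj with h | h
      · exact h.1
      · have := congrArg m h7
        rw [hm.invol, h.2] at this
        simp at this
    · refine ⟨b, hbx, ⟨6, by rw [← h6, hm.invol]⟩, fun v j hj => ?_, Or.inr ⟨rfl, h4, h3, h1⟩⟩
      rcases hport v j hj with h | h
      · have := congrArg m h1
        rw [hm.invol, h.2] at this
        simp at this
      · exact h.1
  let ρ : {v // v ≠ x} ⊕ Fin 8 → V := Sum.elim Subtype.val (fun _ => x)
  let μ : V → V := fun v => if h : v = x then z else ρ (m (.inl ⟨v, h⟩))
  have hμx : μ x = z := by simp [μ]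
  have hμ : ∀ v : {v // v ≠ x}, μ v = ρ (m (.inl v)) := fun v => by simp [μ, v.2]
  have hxz : B.Adj x z := (hx z).2 (by rcases hz' with h | h <;> simp [h.1])
  have hzu : z ≠ u := by
    rintro rfl
    obtain ⟨j, hj⟩ := hz
    rw [fu] at hj; simp at hj
  refine ⟨μ, ⟨fun v => ?_, ?_, fun v hv => ?_⟩, fun v w h => by simp [hμ, h, ρ], by rwa [hμx]⟩
  · by_cases hv : v = x
    · subst hv
      obtain ⟨j, hj⟩ := hz
      rw [hμx, hμ ⟨z, hzx⟩, hj]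
      rfl
    · have h1 := hμ ⟨v, hv⟩
      have hinv := hm.invol (.inl ⟨v, hv⟩)
      rcases h : m (.inl ⟨v, hv⟩) with w | j
      · rw [h] at h1 hinv
        rw [show μ v = w from h1, hμ w, hinv]
        rfl
      · rw [h] at h1
        rw [show μ v = x from h1, hμx]
        exact (hzuniq _ _ h).symm
  · rintro v rfl
    rw [hμ ⟨v, hux⟩, fu]
    rfl
  · by_cases hvx : v = x
    · subst hvx; rw [hμx]; exact hxz
    · have h1 := hμ ⟨v, hvx⟩
      have hadj := hm.adj (.inl ⟨v, hvx⟩) (by simpa using hv)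
      rcases h : m (.inl ⟨v, hvx⟩) with w | j
      · rw [h] at h1 hadj
        rw [show μ v = w from h1]
        exact hadj
      · rw [h] at h1 hadj
        rw [show μ v = x from h1]
        exact hadj.1.symm

/-- Let all degrees of the 2-edge-connected graph `B` be 3, except that `u` has degree 2. By the
conjecture `B` has two matchings covering exactly the vertices other than `u` whose deletion leaves
a bipartite graph. To see this, replace a neighbour `x` of `u` by the Petersen graph minus two
adjacent vertices and apply `hasS4Off_pair`. If the two resulting matchings leave the copy at
different vertices, `x` only keeps its edge to `u`; if they leave it at the same vertex, the
remaining edges contain a path of even length through the copy, which makes `u` and the other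
remaining neighbour of `x` equal in colour. -/
theorem hasS4Off_singleton (hS4 : S4Conjecture) [Finite V] {u : V} (hB : B.IsTwoEdgeConn)
    (hdu : (B.neighborSet u).ncard = 2) (hd : ∀ v, v ≠ u → (B.neighborSet v).ncard = 3) :
    B.HasS4Off {u} := by
  classical
  obtain ⟨x, hux⟩ : (B.neighborSet u).Nonempty := Set.nonempty_of_ncard_ne_zero (by omega)
  have hux : B.Adj u x := hux
  obtain ⟨a, b, hab, hset⟩ : ∃ a b, a ≠ b ∧ B.neighborSet x \ {u} = {a, b} := by
    rw [← Set.ncard_eq_two, Set.ncard_sdiff_singleton_of_mem (show u ∈ B.neighborSet x from hux.symm),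
      hd x hux.ne']
  have hua : u ≠ a := by
    rintro rfl
    exact (hset.symm ▸ (by simp : u ∈ ({u, b} : Set V)) : u ∈ B.neighborSet x \ {u}).2 rfl
  have hub : u ≠ b := by
    rintro rfl
    exact (hset.symm ▸ (by simp : u ∈ ({a, u} : Set V)) : u ∈ B.neighborSet x \ {u}).2 rfl
  have hx : ∀ v, B.Adj x v ↔ v = u ∨ v = a ∨ v = b := by
    intro v
    have := Set.ext_iff.1 hset v
    simp only [Set.mem_sdiff, mem_neighborSet, Set.mem_singleton_iff, Set.mem_insert_iff] at this
    by_cases hv : v = u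
    · subst hv; simp [hux.symm]
    · simpa [hv] using this
  have hax : a ≠ x := ((hx a).2 (by simp)).ne'
  have hbx : b ≠ x := ((hx b).2 (by simp)).ne'
  let port : V → Fin 8 := fun v => if v = u then 4 else if v = a then 2 else 6
  have hpu : port u = 4 := by simp [port]
  have hpa : port a = 2 := by simp [port, hua.symm]
  have hpb : port b = 6 := by simp [port, hub.symm, hab.symm]
  let P := expandVertex B x petersenMinusEdge port
  have hport : ∀ v w, B.Adj x v → B.Adj x w → port w = port v → w = v := by
    intro v w hv hw h
    rcases (hx v).1 hv with rfl | rfl | rfl <;> rcases (hx w).1 hw with rfl | rfl | rfl <;>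
      first | rfl | (simp only [hpu, hpa, hpb] at h; exact absurd h (by decide))
  have hinl : ∀ v : {v // v ≠ x}, (P.neighborSet (.inl v)).ncard = (B.neighborSet v).ncard :=
    fun v => ncard_neighborSet_expandVertex_inl v
  have hinr : ∀ v, B.Adj x v → (P.neighborSet (.inr (port v))).ncard =
      (petersenMinusEdge.neighborSet (port v)).ncard + 1 :=
    fun v hv => ncard_neighborSet_expandVertex_port hv fun w hw h => hport v w hv hw h
  have hinr' : ∀ j, j ≠ 4 → j ≠ 2 → j ≠ 6 → (P.neighborSet (.inr j)).ncard =
      (petersenMinusEdge.neighborSet j).ncard := fun j h4 h2 h6 =>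
    ncard_neighborSet_expandVertex_inr fun v hv => by
      rcases (hx v).1 hv with rfl | rfl | rfl
      exacts [hpu ▸ h4.symm, hpa ▸ h2.symm, hpb ▸ h6.symm]
  have hP : P.HasS4Off {.inl ⟨u, hux.ne⟩, .inr 0} := by
    refine hasS4Off_pair hS4 (by simp)
      (isTwoEdgeConn_expandVertex hB isTwoEdgeConn_petersenMinusEdge) ?_ ?_ ?_
    · rw [hinl, hdu]
    · rw [hinr' 0 (by decide) (by decide) (by decide), ncard_neighborSet_petersenMinusEdge]
      rfl
    · rintro (v | j) h1 h2
      · rw [hinl]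
        exact hd v fun h => h1 (congrArg _ (Subtype.ext h))
      · have h0 : j ≠ 0 := fun h => h2 (h ▸ rfl)
        by_cases h4 : j = 4
        · rw [h4, ← hpu, hinr u hux.symm, hpu, ncard_neighborSet_petersenMinusEdge]; rfl
        by_cases h2 : j = 2
        · rw [h2, ← hpa, hinr a ((hx a).2 (by simp)), hpa, ncard_neighborSet_petersenMinusEdge]; rfl
        by_cases h6 : j = 6
        · rw [h6, ← hpb, hinr b ((hx b).2 (by simp)), hpb, ncard_neighborSet_petersenMinusEdge]; rfl
        rw [hinr' j h4 h2 h6, ncard_neighborSet_petersenMinusEdge]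
        have hodd : ∀ j : Fin 8, j ≠ 0 → j ≠ 4 → j ≠ 2 → j ≠ 6 →
            (if j.val % 2 = 0 then 2 else 3) = 3 := by decide
        exact hodd j h0 h4 h2 h6
  obtain ⟨m₁, m₂, c, hm₁, hm₂, hc⟩ := hP
  obtain ⟨μ₁, hμ₁, e₁, h₁⟩ := hm₁.exists_contract hx hux.ne hax hbx hpu hpa hpb
  obtain ⟨μ₂, hμ₂, e₂, h₂⟩ := hm₂.exists_contract hx hux.ne hax hbx hpu hpa hpb
  have fu₁ : m₁ (.inl ⟨u, hux.ne⟩) = .inl ⟨u, hux.ne⟩ := hm₁.fixed _ (by simp)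
  have fu₂ : m₂ (.inl ⟨u, hux.ne⟩) = .inl ⟨u, hux.ne⟩ := hm₂.fixed _ (by simp)
  have hpath : ∀ p q r s t : Bool, p ≠ q → q ≠ r → r ≠ s → s ≠ t → t = p := by decide
  -- The colour of `x` is the one not used at `u`.
  have hxcol : ∀ v (hv : v ≠ x), B.Adj x v → μ₁ x ≠ v → μ₂ x ≠ v →
      c (.inl ⟨v, hv⟩) = c (.inl ⟨u, hux.ne⟩) := by
    intro v hv hxv n₁ n₂
    have hu4 : c (.inl ⟨u, hux.ne⟩) ≠ c (.inr 4) :=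
      hc _ _ ⟨hux.symm, hpu⟩ (by simp [fu₁]) (by simp [fu₂])
    rcases (hx v).1 hxv with rfl | rfl | rfl
    · rfl
    · -- Both matchings leave the copy at `6`, and the path `u, 4, 3, 2, a` remains.
      obtain ⟨-, p4, p3, p1⟩ := h₁.resolve_left fun h => n₁ h.1
      obtain ⟨-, q4, q3, q1⟩ := h₂.resolve_left fun h => n₂ h.1
      have p2 : m₁ (.inr 2) = .inr 1 := by rw [← p1, hm₁.invol]
      have q2 : m₂ (.inr 2) = .inr 1 := by rw [← q1, hm₂.invol]
      have h43 : c (.inr 4) ≠ c (.inr 3) :=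
        hc _ _ (show petersenMinusEdge.Adj 4 3 by decide) (by simp [p4]) (by simp [q4])
      have h32 : c (.inr 3) ≠ c (.inr 2) :=
        hc _ _ (show petersenMinusEdge.Adj 3 2 by decide) (by simp [p3]) (by simp [q3])
      have h2a : c (.inr 2) ≠ c (.inl ⟨v, hv⟩) :=
        hc _ _ ⟨hxv, hpa⟩ (by simp [p2]) (by simp [q2])
      exact hpath _ _ _ _ _ hu4 h43 h32 h2a
    · -- Both matchings leave the copy at `2`, and the path `u, 4, 5, 6, b` remains.
      obtain ⟨-, p4, p5, p7⟩ := h₁.resolve_right fun h => n₁ h.1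
      obtain ⟨-, q4, q5, q7⟩ := h₂.resolve_right fun h => n₂ h.1
      have p6 : m₁ (.inr 6) = .inr 7 := by rw [← p7, hm₁.invol]
      have q6 : m₂ (.inr 6) = .inr 7 := by rw [← q7, hm₂.invol]
      have h45 : c (.inr 4) ≠ c (.inr 5) :=
        hc _ _ (show petersenMinusEdge.Adj 4 5 by decide) (by simp [p4]) (by simp [q4])
      have h56 : c (.inr 5) ≠ c (.inr 6) :=
        hc _ _ (show petersenMinusEdge.Adj 5 6 by decide) (by simp [p5]) (by simp [q5])
      have h6b : c (.inr 6) ≠ c (.inl ⟨v, hv⟩) :=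
        hc _ _ ⟨hxv, hpb⟩ (by simp [p6]) (by simp [q6])
      exact hpath _ _ _ _ _ hu4 h45 h56 h6b
  refine ⟨μ₁, μ₂, fun v => if h : v = x then !c (.inl ⟨u, hux.ne⟩) else c (.inl ⟨v, h⟩), hμ₁, hμ₂,
    fun v w hvw n₁ n₂ => ?_⟩
  by_cases hv : v = x
  · subst hv
    simp [hvw.ne', hxcol w hvw.ne' hvw n₁ n₂]
  by_cases hw : w = x
  · subst hw
    have := hxcol v hv hvw.symm (fun h => n₁ (by rw [← h, hμ₁.invol]))
      (fun h => n₂ (by rw [← h, hμ₂.invol]))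
    simp [hv, this]
  · simp only [hv, hw, dite_false]
    exact hc _ _ hvw (fun h => n₁ (e₁ ⟨v, hv⟩ ⟨w, hw⟩ h)) (fun h => n₂ (e₂ ⟨v, hv⟩ ⟨w, hw⟩ h))

end SimpleGraph

/-! ### Bridges and the components left after their deletion -/

namespace SimpleGraph

variable {V : Type*} {G : SimpleGraph V}

/-- The graph `G` with all its bridges deleted. -/
def withoutBridges (G : SimpleGraph V) : SimpleGraph V := G.deleteEdges G.bridgeSet

lemma withoutBridges_adj {u v : V} :
    G.withoutBridges.Adj u v ↔ G.Adj u v ∧ s(u, v) ∉ G.bridgeSet := by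
  simp [withoutBridges]

/-- Deleting bridges creates no new bridges, since an edge that is not a bridge lies on a cycle, and
so do all edges of that cycle. -/
lemma reachable_withoutBridges_deleteEdges {x y : V} (h : G.withoutBridges.Adj x y) :
    (G.withoutBridges.deleteEdges {s(x, y)}).Reachable x y := by
  obtain ⟨hadj, hnb⟩ := withoutBridges_adj.1 h
  have hreach : (G.deleteEdges {s(x, y)}).Reachable x y := by
    by_contra hno
    exact hnb ⟨hadj, hno⟩
  obtain ⟨u, p, hp, he⟩ := adj_and_reachable_delete_edges_iff_exists_cycle.1 ⟨hadj, hreach⟩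
  have hp' : ∀ e ∈ p.edges, e ∈ G.withoutBridges.edgeSet := fun e he => by
    rw [withoutBridges, edgeSet_deleteEdges]
    exact ⟨p.edges_subset_edgeSet he, fun hb => hb.2.notMem_edges_of_isCycle hp he⟩
  exact (adj_and_reachable_delete_edges_iff_exists_cycle.2
    ⟨u, p.transfer _ hp', hp.transfer hp', by rwa [Walk.edges_transfer]⟩).2

lemma isTwoEdgeConn_toSimpleGraph
    (hG : ∀ x y, G.Adj x y → (G.deleteEdges {s(x, y)}).Reachable x y)
    (C : G.ConnectedComponent) : C.toSimpleGraph.IsTwoEdgeConn := by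
  intro f a b hf
  have hdel : ∀ u v, G.Reachable u v → (G.deleteEdges {s(a.1, b.1)}).Reachable u v := by
    rintro u v ⟨p⟩
    induction p with
    | nil => exact Reachable.refl _
    | @cons u v w h _ ih =>
      refine Reachable.trans ?_ ih
      by_cases he : s(u, v) = s(a.1, b.1)
      · rw [← he]; exact hG _ _ h
      · exact Adj.reachable (by rw [deleteEdges_adj]; exact ⟨h, by simpa using he⟩)
  have hwalk : ∀ u v, (G.deleteEdges {s(a.1, b.1)}).Walk u v → ∀ (hu : u ∈ C) (hv : v ∈ C),
      f ⟨u, hu⟩ = f ⟨v, hv⟩ := by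
    intro u v p
    induction p with
    | nil => intros; rfl
    | @cons u v w h _ ih =>
      intro hu hw
      rw [deleteEdges_adj] at h
      have hv : v ∈ C := C.mem_supp_of_adj_mem_supp hu h.1
      refine (hf ⟨u, hu⟩ ⟨v, hv⟩ h.1 fun he => h.2 ?_).trans (ih hv hw)
      simpa using congrArg (Sym2.map Subtype.val) he
  rintro ⟨u, hu⟩ ⟨v, hv⟩
  exact hwalk u v (hdel u v (C.reachable_of_mem_supp hu hv)).some hu hv

lemma Preconnected.reachable_deleteEdges_or (hG : G.Preconnected) (w w' z : V) :
    (G.deleteEdges {s(w, w')}).Reachable w z ∨ (G.deleteEdges {s(w, w')}).Reachable w' z := by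
  have hwalk : ∀ u v, G.Walk u v → (G.deleteEdges {s(w, w')}).Reachable v z ∨
      (G.deleteEdges {s(w, w')}).Reachable w z ∨ (G.deleteEdges {s(w, w')}).Reachable w' z →
      (G.deleteEdges {s(w, w')}).Reachable u z ∨
      (G.deleteEdges {s(w, w')}).Reachable w z ∨ (G.deleteEdges {s(w, w')}).Reachable w' z := by
    intro u v p
    induction p with
    | nil => exact id
    | @cons u v _ h _ ih =>
      intro hz
      rcases ih hz with h' | h'
      · by_cases he : s(u, v) = s(w, w')
        · rcases Sym2.eq_iff.1 he with ⟨-, rfl⟩ | ⟨-, rfl⟩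
          · exact Or.inr (Or.inr h')
          · exact Or.inr (Or.inl h')
        · exact Or.inl (Reachable.trans
            (Adj.reachable (by rw [deleteEdges_adj]; exact ⟨h, by simpa using he⟩)) h')
      · exact Or.inr h'
  rcases hwalk w z (hG w z).some (Or.inl (Reachable.refl _)) with h | h
  exacts [Or.inl h, h]

lemma not_reachable_withoutBridges {w w' : V} (h : s(w, w') ∈ G.bridgeSet) :
    ¬ G.withoutBridges.Reachable w w' := fun hr =>
  h.2 (hr.mono (deleteEdges_anti (by simpa using h)))

/-- For two bridges that leave the same component of `G.withoutBridges`, from `w` to `w'` and from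
`x` to `x'`, the parts of `G` beyond these bridges are disjoint. -/
lemma reachable_or_of_bridges (hG : G.Preconnected) {w w' x x' : V}
    (hw : s(w, w') ∈ G.bridgeSet) (hx : s(x, x') ∈ G.bridgeSet) (hne : s(w, w') ≠ s(x, x'))
    (hwx : G.withoutBridges.Reachable w x) (z : V) :
    (G.deleteEdges {s(w, w')}).Reachable w z ∨ (G.deleteEdges {s(x, x')}).Reachable x z := by
  rw [or_iff_not_imp_left]
  intro hz
  have hz' := (hG.reachable_deleteEdges_or w w' z).resolve_left hz
  have hwx₁ : (G.deleteEdges {s(w, w')}).Reachable w x :=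
    hwx.mono (deleteEdges_anti (by simpa using hw))
  have hwx₂ : (G.deleteEdges {s(x, x')}).Reachable w x :=
    hwx.mono (deleteEdges_anti (by simpa using hx))
  -- A walk from `w'` that avoids the first bridge never meets `x`, hence avoids the second one.
  have hwalk : ∀ u v, (G.deleteEdges {s(w, w')}).Walk u v →
      (G.deleteEdges {s(w, w')}).Reachable w' u → (G.deleteEdges {s(x, x')}).Reachable u v := by
    intro u v p
    induction p with
    | nil => intro; exact Reachable.refl _
    | @cons u v _ h _ ih =>
      intro hu
      have hv := hu.trans h.reachable
      have hx' : ∀ t, (G.deleteEdges {s(w, w')}).Reachable w' t → t ≠ x := by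
        rintro t ht rfl
        exact hw.2 (hwx₁.trans ht.symm)
      refine Reachable.trans (Adj.reachable ?_) (ih hv)
      rw [deleteEdges_adj] at h ⊢
      refine ⟨h.1, fun he => ?_⟩
      rcases Sym2.eq_iff.1 (Set.mem_singleton_iff.1 he) with ⟨h1, -⟩ | ⟨-, h1⟩
      · exact hx' u hu h1
      · exact hx' v hv h1
  have hww' : (G.deleteEdges {s(x, x')}).Adj w w' := by
    rw [deleteEdges_adj]; exact ⟨hw.1, by simpa using hne⟩
  exact hwx₂.symm.trans (hww'.reachable.trans (hwalk w' z hz'.some (Reachable.refl _)))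

/-- A trail through a bridge separates its ends. -/
lemma Walk.IsTrail.not_reachable_of_bridge {u v : V} {p : G.Walk u v} (hp : p.IsTrail)
    {e : Sym2 V} (he : e ∈ p.edges) (hb : G.IsBridge e) : ¬ (G.deleteEdges {e}).Reachable u v := by
  induction p with
  | nil => simp at he
  | @cons u v w h q ih =>
    rw [Walk.isTrail_cons] at hp
    rw [Walk.edges_cons, List.mem_cons] at he
    intro hr
    by_cases heq : e = s(u, v)
    · subst heq
      exact hb (hr.trans (Walk.reachable (q.toDeleteEdge _ hp.2)).symm)
    · refine ih hp.1 (he.resolve_left heq) (Reachable.trans (Adj.reachable ?_) hr)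
      rw [deleteEdges_adj]
      exact ⟨h.symm, by simpa [Sym2.eq_swap] using fun h => heq h.symm⟩

/-- If all bridges lie on a trail, no component of `G.withoutBridges` meets three bridges: beyond
each of them lies an end of the trail. -/
lemma not_three_bridges (hG : G.Preconnected) {a b : V} {p : G.Walk a b} (hp : p.IsTrail)
    (hpb : ∀ e ∈ G.bridgeSet, e ∈ p.edges) (w w' : Fin 3 → V)
    (hb : ∀ i, s(w i, w' i) ∈ G.bridgeSet)
    (hne : ∀ i j, i ≠ j → s(w i, w' i) ≠ s(w j, w' j))
    (hr : ∀ i j, G.withoutBridges.Reachable (w i) (w j)) : False := by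
  have hend : ∀ i, ∃ z : Bool, ¬ (G.deleteEdges {s(w i, w' i)}).Reachable (w i) (cond z a b) := by
    intro i
    by_contra! hall
    exact hp.not_reachable_of_bridge (hpb _ (hb i)) (hb i).2 ((hall true).symm.trans (hall false))
  choose z hz using hend
  obtain ⟨i, j, hij, hzij⟩ := Fintype.exists_ne_map_eq_of_card_lt z (by simp)
  rcases reachable_or_of_bridges hG (hb i) (hb j) (hne i j hij) (hr i j) (cond (z i) a b) with h | h
  · exact hz i h
  · exact hz j (hzij ▸ h)

/-! ### Matchings of the components -/

/-- The vertices of a component of `G.withoutBridges` that are incident to bridges of `G`. -/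
def bridgeFeet {G : SimpleGraph V} (C : G.withoutBridges.ConnectedComponent) : Set C :=
  {w | ∃ w', s(w.1, w') ∈ G.bridgeSet}

lemma ncard_neighborSet_toSimpleGraph (C : G.ConnectedComponent) (w : C) :
    (C.toSimpleGraph.neighborSet w).ncard = (G.neighborSet w.1).ncard := by
  have : G.neighborSet w.1 = Subtype.val '' C.toSimpleGraph.neighborSet w := by
    ext v
    refine ⟨fun h => ⟨⟨v, C.mem_supp_of_adj_mem_supp w.2 h⟩, h, rfl⟩, ?_⟩
    rintro ⟨v, h, rfl⟩
    exact h
  rw [this, Set.ncard_image_of_injective _ Subtype.val_injective]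

lemma ncard_neighborSet_withoutBridges [Finite V] (w : V) :
    (G.withoutBridges.neighborSet w).ncard =
      (G.neighborSet w).ncard - {w' | s(w, w') ∈ G.bridgeSet}.ncard := by
  rw [← Set.ncard_sdiff (fun w' h => h.1)]
  congr 1
  ext w'
  simp [withoutBridges_adj]

/-- A vertex of a cubic graph does not lie on exactly two bridges: it would have degree 1 in
`G.withoutBridges`, and its edge there would be a bridge. -/
lemma eq_of_mem_bridgeSet [Finite V] (hcubic : ∀ v, (G.neighborSet v).ncard = 3) {w w₁ w₂ : V}
    (h3 : ∀ x, s(w, x) ∈ G.bridgeSet → x = w₁ ∨ x = w₂)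
    (h₁ : s(w, w₁) ∈ G.bridgeSet) (h₂ : s(w, w₂) ∈ G.bridgeSet) : w₁ = w₂ := by
  by_contra hne
  have hset : {w' | s(w, w') ∈ G.bridgeSet} = {w₁, w₂} := by
    ext x
    refine ⟨h3 x, ?_⟩
    rintro (rfl | rfl) <;> assumption
  have hcard := ncard_neighborSet_withoutBridges (G := G) w
  rw [hset, Set.ncard_pair hne, hcubic] at hcard
  obtain ⟨y, hy⟩ := Set.ncard_eq_one.1 hcard
  have hwy : G.withoutBridges.Adj w y := by
    rw [← mem_neighborSet, hy]; rfl
  obtain ⟨p⟩ := reachable_withoutBridges_deleteEdges hwy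
  cases p with
  | nil => exact hwy.ne rfl
  | @cons _ v _ h _ =>
    rw [deleteEdges_adj] at h
    have hv : v ∈ G.withoutBridges.neighborSet w := h.1
    rw [hy] at hv
    obtain rfl : v = y := hv
    exact h.2 rfl

/-- If every component of `G.withoutBridges` has matchings as required that miss exactly its
vertices on bridges, then the bridges complete these to an `S₄`-pair of `G`. -/
lemma hasS4Off_empty_of_components
    (huniq : ∀ w w₁ w₂, s(w, w₁) ∈ G.bridgeSet → s(w, w₂) ∈ G.bridgeSet → w₁ = w₂)
    (hC : ∀ C : G.withoutBridges.ConnectedComponent, C.toSimpleGraph.HasS4Off (bridgeFeet C)) :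
    G.HasS4Off ∅ := by
  classical
  choose m₁ m₂ c h₁ h₂ hc using hC
  let K : V → G.withoutBridges.ConnectedComponent := G.withoutBridges.connectedComponentMk
  let glue : (∀ C : G.withoutBridges.ConnectedComponent, C → C) → V → V := fun m w =>
    if h : ∃ w', s(w, w') ∈ G.bridgeSet then h.choose else (m (K w) ⟨w, rfl⟩).1
  have glue_bridge : ∀ m w w', s(w, w') ∈ G.bridgeSet → glue m w = w' := by
    intro m w w' h
    have hex : ∃ w', s(w, w') ∈ G.bridgeSet := ⟨w', h⟩
    simp only [glue, dif_pos hex]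
    exact huniq w _ _ hex.choose_spec h
  have glue_comp : ∀ m (C : G.withoutBridges.ConnectedComponent) (w : C), w ∉ bridgeFeet C →
      glue m w = (m C w).1 := by
    rintro m C ⟨w, rfl⟩ hw
    exact dif_neg hw
  have hglue : ∀ m : ∀ C : G.withoutBridges.ConnectedComponent, C → C,
      (∀ C : G.withoutBridges.ConnectedComponent,
        C.toSimpleGraph.IsPartnerMap (bridgeFeet C) (m C)) →
      G.IsPartnerMap ∅ (glue m) := by
    intro m hm
    refine ⟨fun w => ?_, by simp, fun w _ => ?_⟩
    · by_cases h : ∃ w', s(w, w') ∈ G.bridgeSet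
      · obtain ⟨w', h⟩ := h
        rw [glue_bridge m w w' h, glue_bridge m w' w (by rwa [Sym2.eq_swap])]
      · have hw : (⟨w, rfl⟩ : K w) ∉ bridgeFeet (K w) := h
        have hw' : m (K w) ⟨w, rfl⟩ ∉ bridgeFeet (K w) := fun h' => by
          have := (hm (K w)).fixed _ h'
          rw [(hm (K w)).invol] at this
          exact hw (this ▸ h')
        rw [glue_comp m (K w) ⟨w, rfl⟩ hw, glue_comp m (K w) _ hw', (hm (K w)).invol]
    · by_cases h : ∃ w', s(w, w') ∈ G.bridgeSet
      · obtain ⟨w', h⟩ := h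
        rw [glue_bridge m w w' h]
        exact h.1
      · have hw : (⟨w, rfl⟩ : K w) ∉ bridgeFeet (K w) := h
        rw [glue_comp m (K w) ⟨w, rfl⟩ hw]
        exact (withoutBridges_adj.1 ((hm (K w)).adj _ hw)).1
  refine ⟨glue m₁, glue m₂, fun w => c (K w) ⟨w, rfl⟩, hglue m₁ h₁, hglue m₂ h₂,
    fun u v huv n₁ n₂ => ?_⟩
  have hnb : s(u, v) ∉ G.bridgeSet := fun h => n₁ (glue_bridge m₁ u v h)
  have hadj : G.withoutBridges.Adj u v := withoutBridges_adj.2 ⟨huv, hnb⟩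
  have hcv : ∀ (C : G.withoutBridges.ConnectedComponent) (w : C), c (K w.1) ⟨w.1, rfl⟩ = c C w := by
    rintro C ⟨w, rfl⟩; rfl
  have hv : v ∈ K u := (K u).mem_supp_of_adj_mem_supp rfl hadj
  dsimp only
  rw [hcv (K u) ⟨v, hv⟩]
  have hm : ∀ m : ∀ C : G.withoutBridges.ConnectedComponent, C → C,
      (∀ C : G.withoutBridges.ConnectedComponent,
        C.toSimpleGraph.IsPartnerMap (bridgeFeet C) (m C)) → glue m u ≠ v →
      m (K u) ⟨u, rfl⟩ ≠ ⟨v, hv⟩ := by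
    intro m hm hne h
    by_cases hu : (⟨u, rfl⟩ : K u) ∈ bridgeFeet (K u)
    · rw [(hm _).fixed _ hu] at h
      exact huv.ne (congrArg Subtype.val h)
    · exact hne (by rw [glue_comp m (K u) ⟨u, rfl⟩ hu, h])
  exact hc (K u) ⟨u, rfl⟩ ⟨v, hv⟩ hadj (hm m₁ h₁ n₁) (hm m₂ h₂ n₂)

end SimpleGraph

theorem mainTheorem9 {V : Type*} [Fintype V] (G : SimpleGraph V) [G.LocallyFinite]
    (hconn : G.Connected) (hcubic : G.IsRegularOfDegree 3)
    (k : ℕ) (hk : 0 < k) (hbridges : G.bridgeSet.ncard = k)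
    (hpath : ∃ (u v : V) (p : G.Walk u v), p.IsPath ∧ ∀ e ∈ G.bridgeSet, e ∈ p.edges)
    (hS4 : S4Conjecture) :
    ∃ M₁ M₂ : G.Subgraph, G.IsS4Pair M₁ M₂ := by
  classical
  rw [← SimpleGraph.hasS4Off_empty_iff]
  obtain ⟨a, b, p, hp, hpb⟩ := hpath
  have hdeg : ∀ v, (G.neighborSet v).ncard = 3 := fun v => by
    rw [← hcubic v, ← SimpleGraph.card_neighborSet_eq_degree, ← Nat.card_eq_fintype_card,
      Nat.card_coe_set_eq]
  -- Bridges leaving the same component with different end points are different edges.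
  have hsym : ∀ x x' y y', s(x, x') ∈ G.bridgeSet → G.withoutBridges.Reachable x y →
      (x, x') ≠ (y, y') → s(x, x') ≠ s(y, y') := by
    intro x x' y y' hx hxy hne h
    rcases Sym2.eq_iff.1 h with ⟨rfl, rfl⟩ | ⟨rfl, rfl⟩
    · exact hne rfl
    · exact SimpleGraph.not_reachable_withoutBridges hx hxy
  have hthree : ∀ x x' y y' z z', s(x, x') ∈ G.bridgeSet → s(y, y') ∈ G.bridgeSet →
      s(z, z') ∈ G.bridgeSet → G.withoutBridges.Reachable x y → G.withoutBridges.Reachable x z →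
      (x, x') ≠ (y, y') → (z, z') = (x, x') ∨ (z, z') = (y, y') := by
    intro x x' y y' z z' hx hy hz hxy hxz hne
    by_contra! hno
    have hyz := hxy.symm.trans hxz
    have n1 := hsym x x' y y' hx hxy hne
    have n2 := hsym x x' z z' hx hxz hno.1.symm
    have n3 := hsym y y' z z' hy hyz hno.2.symm
    refine SimpleGraph.not_three_bridges hconn.preconnected hp.isTrail hpb ![x, y, z] ![x', y', z']
      ?_ ?_ ?_
    · intro i; fin_cases i <;> assumption
    · intro i j hij
      fin_cases i <;> fin_cases j <;> first | exact absurd rfl hij | assumption |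
        exact Ne.symm (by assumption)
    · intro i j
      fin_cases i <;> fin_cases j <;> first | exact SimpleGraph.Reachable.refl _ | assumption |
        exact SimpleGraph.Reachable.symm (by assumption)
  have huniq : ∀ w w₁ w₂, s(w, w₁) ∈ G.bridgeSet → s(w, w₂) ∈ G.bridgeSet → w₁ = w₂ := by
    intro w w₁ w₂ h₁ h₂
    by_contra hne
    refine hne (SimpleGraph.eq_of_mem_bridgeSet hdeg (fun x hx => ?_) h₁ h₂)
    have := hthree w w₁ w w₂ w x h₁ h₂ hx (.refl _) (.refl _) (by simpa using hne)
    simpa using this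
  refine SimpleGraph.hasS4Off_empty_of_components huniq fun C => ?_
  have hC := SimpleGraph.isTwoEdgeConn_toSimpleGraph
    (fun x y h => SimpleGraph.reachable_withoutBridges_deleteEdges (G := G) h) C
  have hfoot : ∀ w : C, w ∈ SimpleGraph.bridgeFeet C → (C.toSimpleGraph.neighborSet w).ncard = 2 := by
    rintro w ⟨w', hw'⟩
    have : {x | s(w.1, x) ∈ G.bridgeSet} = {w'} := by
      ext x
      exact ⟨fun h => huniq _ _ _ h hw', fun h => h ▸ hw'⟩
    rw [SimpleGraph.ncard_neighborSet_toSimpleGraph, SimpleGraph.ncard_neighborSet_withoutBridges,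
      hdeg, this, Set.ncard_singleton]
  have hnonfoot : ∀ w : C, w ∉ SimpleGraph.bridgeFeet C → (C.toSimpleGraph.neighborSet w).ncard = 3 := by
    intro w hw
    have : {x | s(w.1, x) ∈ G.bridgeSet} = ∅ := by
      ext x
      exact ⟨fun h => hw ⟨x, h⟩, fun h => h.elim⟩
    rw [SimpleGraph.ncard_neighborSet_toSimpleGraph, SimpleGraph.ncard_neighborSet_withoutBridges,
      hdeg, this, Set.ncard_empty]
  -- Some bridge leaves `C`, as otherwise `C` would contain every vertex.
  obtain ⟨s, s', hs⟩ : ∃ (s : C) (s' : V), s(s.1, s') ∈ G.bridgeSet := by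
    by_contra! hno
    obtain ⟨e, he⟩ := Set.nonempty_of_ncard_ne_zero (hbridges.trans_ne hk.ne')
    induction e with | _ x y
    have hwalk : ∀ u v, G.Walk u v → u ∈ C → v ∈ C := by
      intro u v q
      induction q with
      | nil => exact id
      | cons h _ ih =>
        exact fun hu => ih (C.mem_supp_of_adj_mem_supp hu
          (SimpleGraph.withoutBridges_adj.2 ⟨h, hno ⟨_, hu⟩ _⟩))
    obtain ⟨w, hw⟩ := C.nonempty_supp
    exact hno ⟨x, hwalk w x (hconn.preconnected w x).some hw⟩ y he
  by_cases hone : SimpleGraph.bridgeFeet C = {s}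
  · rw [hone]
    exact SimpleGraph.hasS4Off_singleton hS4 hC (hfoot s ⟨s', hs⟩) fun v hv =>
      hnonfoot v (by rwa [hone])
  · obtain ⟨t, ⟨t', ht⟩, hts⟩ : ∃ t ∈ SimpleGraph.bridgeFeet C, t ≠ s := by
      by_contra! hall
      exact hone (Set.Subset.antisymm hall (by rintro _ rfl; exact ⟨s', hs⟩))
    have htwo : SimpleGraph.bridgeFeet C = {s, t} := by
      refine Set.Subset.antisymm ?_ (by rintro _ (rfl | rfl); exacts [⟨s', hs⟩, ⟨t', ht⟩])
      rintro v ⟨v', hv⟩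
      have := hthree s s' t t' v v' hs ht hv (C.reachable_of_mem_supp s.2 t.2)
        (C.reachable_of_mem_supp s.2 v.2) (fun h => hts (Subtype.ext (congrArg Prod.fst h)).symm)
      rcases this with h | h
      · exact Or.inl (Subtype.ext (congrArg Prod.fst h))
      · exact Or.inr (Subtype.ext (congrArg Prod.fst h))
    rw [htwo]
    exact SimpleGraph.hasS4Off_pair hS4 hts.symm hC (hfoot s ⟨s', hs⟩) (hfoot t ⟨t', ht⟩)
      fun w h1 h2 => hnonfoot w (by rw [htwo]; simp [h1, h2])
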